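/- Use oblique coordinates in the plane: $(x,y)$ stands for the point $x+y\omega$ with $\omega=e^{i\pi/3}$, so that the points with $x,y\in\mathbb{Z}$ form the unit triangular lattice. A lozenge is the union of two unit lattice triangles that share an edge, and a lozenge tiling of a union $R$ of unit triangles is a set of lozenges contained in $R$ that covers every unit triangle of $R$ exactly once. For a natural number $a$ let $H(a,a,a)$ be the regular hexagon with side $a$ and centre $0$, with corners $(a,0),(0,a),(-a,a),(-a,0),(0,-a),(a,-a)$. Let $T_a$ be the region obtained from $H(a,a,a)$ by removing, at each of the three alternating corners $(a,0),(-a,a),(0,-a)$, the staircase of shape $(a-1,a-2,\dots,1)$: if $c$ is the corner and $u,w$ are the unit vectors along the two sides of the hexagon that meet at $c$, this is the union of the lozenges with vertices $P,\ P+u,\ P+u+w,\ P+w$, where $P=c+iu+jw$ with integers $i,j\ge 0$ and $i+j<a-1$. (For $a\le 1$ nothing is removed; $T_0$ is empty.) The weak dual graph of $T_a$ has the unit triangles of $T_a$ as vertices, and an edge for every two of them that share an edge. The special hexagons of $T_a$ are the hexagons of the weak dual, each formed by the six unit triangles around a lattice point $(x,y)$ and all of them in $T_a$, for which $x-y\equiv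 1-a \pmod 3$; the point $(x,y)$ is the centre of the special hexagon. Let $t_a$ be the graph whose vertices are the centres of the special hexagons of $T_a$, two distinct centres being joined by a straight segment if and only if an edge of the weak dual of $T_a$ connects the two hexagons. For a graph $g$ with a straight-line drawing in the plane, a Lucas-Coloring of $g$ is a colouring of its edges by two colours $y,n$ such that, at every vertex $v$, the set of $n$-coloured edges at $v$ can be partitioned into pairs of distinct edges that are consecutive in the cyclic order of all edges around $v$. Let $Luc(g)$ be the set of Lucas-Colorings of $g$, and for $A\in Luc(g)$ let $Sp(A)$ be the number of special vertices of $A$, that is, vertices all of whose incident edges are coloured $n$ (an isolated vertex is special). Theorem. For every natural number $a$: every unit triangle of $T_a$ belongs to exactly one special hexagon; the drawing of $t_a$ is plane (distinct edges meet only at common ends, and vertices lie only on edges incident to them), so that $t_a$ is a planar graph; and \[ \#\{\text{lozenge tilings of } T_a\} \;=\; \sum_{A\in Luc(t_a)} 2^{Sp(A)} . \] -/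

import Mathlib

namespace LucasTiling

/-! Points of the unit triangular lattice are written in oblique coordinates: `(x, y)` stands for
`x + y ω` with `ω = exp (i π / 3)`. -/

/-- A point of the triangular lattice. -/
abbrev Pt := ℤ × ℤ

/-- The position of a lattice point in the Euclidean plane `ℂ`. -/
noncomputable def Pt.toPlane (p : Pt) : ℂ :=
  (p.1 : ℂ) + (p.2 : ℂ) * Complex.exp ((Real.pi / 3 : ℝ) * Complex.I)

/-- A unit triangle of the triangular lattice, either pointing up, with vertices
`(x, y), (x + 1, y), (x, y + 1)`, or pointing down, with vertices
`(x + 1, y), (x, y + 1), (x + 1, y + 1)`. -/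
@[ext]
structure Tri where
  x : ℤ
  y : ℤ
  up : Bool
deriving DecidableEq

/-- The three vertices of a unit triangle. -/
def Tri.verts (t : Tri) : Finset Pt :=
  if t.up then {(t.x, t.y), (t.x + 1, t.y), (t.x, t.y + 1)}
  else {(t.x + 1, t.y), (t.x, t.y + 1), (t.x + 1, t.y + 1)}

/-- Two unit triangles are adjacent if they share an edge, that is, exactly two vertices. -/
def Tri.Adjacent (s t : Tri) : Prop := (s.verts ∩ t.verts).card = 2

/-- A lozenge is the union of two unit triangles that share an edge. -/
def IsLozenge (L : Set Tri) : Prop := ∃ s t : Tri, s.Adjacent t ∧ L = {s, t}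

/-- A lozenge tiling of a region `R` (a set of unit triangles): a set of lozenges contained in `R`
such that every unit triangle of `R` is covered by exactly one of them. -/
def IsLozengeTiling (R : Set Tri) (𝒯 : Set (Set Tri)) : Prop :=
  (∀ L ∈ 𝒯, IsLozenge L ∧ L ⊆ R) ∧ ∀ t ∈ R, ∃! L, L ∈ 𝒯 ∧ t ∈ L

/-- The number of lozenge tilings of a region. -/
noncomputable def numLozengeTilings (R : Set Tri) : ℕ :=
  Nat.card {𝒯 : Set (Set Tri) // IsLozengeTiling R 𝒯}

/-- The unit triangles of the regular hexagon `H(a,a,a)` with centre at the origin. Its corners are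
`(a, 0), (0, a), (-a, a), (-a, 0), (0, -a), (a, -a)`, in counterclockwise order. -/
def hexagonRegion (a : ℕ) : Set Tri :=
  {t | ∀ p ∈ t.verts, |p.1| ≤ (a : ℤ) ∧ |p.2| ≤ (a : ℤ) ∧ |p.1 + p.2| ≤ (a : ℤ)}

/-- The staircase `(m, m - 1, …, 1)` with corner `c` and sides in the directions `u` and `w`: the
unit triangles of the rhombi with vertices `P, P + u, P + w, P + u + w`, where
`P = c + i u + j w` with `i, j ≥ 0` and `i + j < m`. -/
def staircase (c u w : Pt) (m : ℕ) : Set Tri :=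
  {t | ∃ i j : ℕ, i + j < m ∧
    t.verts ⊆ {c + i • u + j • w, c + i • u + j • w + u, c + i • u + j • w + w,
      c + i • u + j • w + u + w}}

/-- The region `T_a`: the hexagon `H(a,a,a)` without the staircases `(a - 1, a - 2, …, 1)` at the
three alternating corners `(a, 0), (-a, a), (0, -a)`; the directions are those of the two sides of
the hexagon that meet at the corner. -/
def regionT (a : ℕ) : Set Tri :=
  hexagonRegion a \
    (staircase ((a : ℤ), 0) (-1, 1) (0, -1) (a - 1) ∪
      staircase (-(a : ℤ), (a : ℤ)) (0, -1) (1, 0) (a - 1) ∪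
      staircase (0, -(a : ℤ)) (1, 0) (-1, 1) (a - 1))

/-- The weak dual graph of a region: its vertices are the unit triangles of the region, and edges
join triangles that share an edge. -/
def weakDual (R : Set Tri) : SimpleGraph R where
  Adj s t := (s : Tri).Adjacent t
  symm := ⟨fun s t h => by
    have h' : ((s : Tri).verts ∩ (t : Tri).verts).card = 2 := h
    show ((t : Tri).verts ∩ (s : Tri).verts).card = 2
    rwa [Finset.inter_comm]⟩
  loopless := ⟨fun s h => by
    have h' : ((s : Tri).verts ∩ (s : Tri).verts).card = 2 := h
    rw [Finset.inter_self] at h'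
    unfold Tri.verts at h'
    split_ifs at h'
    · rw [Finset.card_eq_three.mpr ⟨_, _, _, by simp, by simp, by simp, rfl⟩] at h'
      omega
    · rw [Finset.card_eq_three.mpr ⟨_, _, _, by simp, by simp, by simp, rfl⟩] at h'
      omega⟩

/-- The hexagon with centre `p` of the dual lattice: the six unit triangles around `p`. -/
def hexagonAt (p : Pt) : Set Tri := {t | p ∈ t.verts}

open Classical in
/-- The centres of the special hexagons of `T_a`: the hexagons of the weak dual of `T_a` whose
centres `(x, y)` satisfy `x - y ≡ 1 - a` modulo `3`. -/
noncomputable def specialCenters (a : ℕ) : Finset Pt :=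
  (Finset.Icc (-(a : ℤ)) a ×ˢ Finset.Icc (-(a : ℤ)) a).filter fun p =>
    hexagonAt p ⊆ regionT a ∧ p.1 - p.2 ≡ 1 - (a : ℤ) [ZMOD 3]

/-- A graph together with a straight-line drawing in the plane `ℂ`. -/
structure Drawing (V : Type*) where
  graph : SimpleGraph V
  pos : V → ℂ

/-- The two colours of a Lucas-colouring. -/
inductive EdgeColor
  | y
  | n
deriving DecidableEq

instance : Fintype EdgeColor where
  elems := {EdgeColor.y, EdgeColor.n}
  complete := fun c => by cases c <;> simp

namespace Drawing

variable {V : Type*} (D : Drawing V)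

/-- The drawing is plane (so that the graph is planar): distinct vertices are at distinct points,
vertices lie only on edges which they are incident to, and two distinct edges meet at most in a
common end. -/
def IsPlane : Prop :=
  Function.Injective D.pos ∧
  (∀ u v w, D.graph.Adj u v → D.pos w ∈ segment ℝ (D.pos u) (D.pos v) → w = u ∨ w = v) ∧
  (∀ u v x y, D.graph.Adj u v → D.graph.Adj x y → s(u, v) ≠ s(x, y) →
    ∀ z, z ∈ segment ℝ (D.pos u) (D.pos v) → z ∈ segment ℝ (D.pos x) (D.pos y) →
      ∃ w, (w = u ∨ w = v) ∧ (w = x ∨ w = y) ∧ z = D.pos w)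

/-- Turning counterclockwise around `v` from the direction of `w`, one meets the direction of `u`
strictly before that of `w'`, in less than a full turn. -/
def CcwBetween (v w u w' : V) : Prop :=
  ∃ r₁ r₂ θ₁ θ₂ : ℝ, 0 < r₁ ∧ 0 < r₂ ∧ 0 < θ₁ ∧ θ₁ < θ₂ ∧ θ₂ < 2 * Real.pi ∧
    D.pos u - D.pos v = r₁ * Complex.exp (θ₁ * Complex.I) * (D.pos w - D.pos v) ∧
    D.pos w' - D.pos v = r₂ * Complex.exp (θ₂ * Complex.I) * (D.pos w - D.pos v)

/-- The edges `vw` and `vw'` are distinct and consecutive in the cyclic order of the edges at `v`: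
one of the two sectors between them contains no further edge at `v`. -/
def Consecutive (v w w' : V) : Prop :=
  D.graph.Adj v w ∧ D.graph.Adj v w' ∧ w ≠ w' ∧
    ((∀ u, D.graph.Adj v u → ¬ D.CcwBetween v w u w') ∨
      (∀ u, D.graph.Adj v u → ¬ D.CcwBetween v w' u w))

/-- The other ends of the `n`-coloured edges at `v`. -/
def nNeighbors (A : D.graph.edgeSet → EdgeColor) (v : V) : Set V :=
  {w | ∃ h : D.graph.Adj v w, A ⟨s(v, w), h⟩ = EdgeColor.n}

/-- An edge colouring is a Lucas-colouring if at every vertex the `n`-coloured edges can be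
partitioned into pairs of consecutive edges. -/
def IsLucasColoring (A : D.graph.edgeSet → EdgeColor) : Prop :=
  ∀ v, ∃ P : Set (Set V), P.PairwiseDisjoint id ∧ ⋃₀ P = D.nNeighbors A v ∧
    ∀ S ∈ P, ∃ w w', D.Consecutive v w w' ∧ S = {w, w'}

/-- The set of all Lucas-colourings. -/
noncomputable def Luc [Finite V] : Finset (D.graph.edgeSet → EdgeColor) :=
  (Set.toFinite {A | D.IsLucasColoring A}).toFinset

/-- The number of special vertices: those all of whose incident edges are coloured `n`. -/
noncomputable def Sp (A : D.graph.edgeSet → EdgeColor) : ℕ :=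
  Nat.card {v : V // ∀ e : D.graph.edgeSet, v ∈ (e : Sym2 V) → A e = EdgeColor.n}

end Drawing

/-- The graph `t_a`: its vertices are the centres of the special hexagons of `T_a`, and the segment
between two of them is an edge if and only if an edge of the weak dual of `T_a` connects the two
hexagons. -/
noncomputable def graphT (a : ℕ) : Drawing (specialCenters a) where
  graph :=
    { Adj := fun p q => p ≠ q ∧ ∃ s t : regionT a, (s : Tri) ∈ hexagonAt p ∧
        (t : Tri) ∈ hexagonAt q ∧ (weakDual (regionT a)).Adj s t
      symm := ⟨fun _ _ ⟨hne, s, t, hs, ht, h⟩ => ⟨hne.symm, t, s, ht, hs, h.symm⟩⟩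
      loopless := ⟨fun _ h => h.1 rfl⟩ }
  pos := fun p => Pt.toPlane p

end LucasTiling

open LucasTiling

namespace LucasTiling

/-! The linear forms 2x+y, y-x and -x-2y sum to 0 and agree mod 3 at lattice points. `T_a` consists
of the unit triangles whose centroid has all three forms at most `a`; the special centres are the
lattice points with all three forms at most `a - 1` and congruent to `a - 1` mod 3. Every unit
triangle has exactly one vertex in that class. From the centroid to this vertex each form grows by
at most 1, and the congruence turns the bound `a + 1` into `a - 1`. So the special hexagons
partition `T_a` (`existsUnique_specialCenters`).

Hence a lozenge either lies in one special hexagon, as an edge of its six-cycle, or crosses one edge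
of `t_a` (`triAt_adjacent`, `range_lozenge`). Colour an edge y if its crossing lozenge is used. The
rest of a tiling is an independent choice, for each special hexagon, of a perfect matching of the
six-cycle without the triangles at y-edges. So the number of tilings is a sum over colourings of
products of local counts (`numLozengeTilings_eq_sum`).

The full six-cycle has 2 matchings. Otherwise the gaps between removed triangles are paths, and
there is 1 matching if all gaps are even and none if one is odd. Directions without an edge come in
adjacent pairs (`pairedDirections_edgeDirections`), each inside one gap, so a gap is even exactly
when it contains an even number of n-edges, that is, when these pair off consecutively. Thus the
local count is 2 at special vertices, 1 at other vertices satisfying the Lucas condition, and 0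
elsewhere (`card_filter_localMatching`, `exists_consecutive_pairs_iff`).

Planarity: the edges join nearest neighbours of a triangular lattice, one class mod 3
(`eq_of_openSegment_inter`). -/

/-! ### Triangles around a lattice point -/

/-- The six unit triangles around `p`, in counterclockwise order. -/
def triAt (p : Pt) : Fin 6 → Tri :=
  ![⟨p.1, p.2, true⟩, ⟨p.1 - 1, p.2, false⟩, ⟨p.1 - 1, p.2, true⟩,
    ⟨p.1 - 1, p.2 - 1, false⟩, ⟨p.1, p.2 - 1, true⟩, ⟨p.1, p.2 - 1, false⟩]

/-- The lattice point opposite to `p` across the far side of `triAt p k`. -/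
def nbr (p : Pt) : Fin 6 → Pt :=
  ![(p.1 + 1, p.2 + 1), (p.1 - 1, p.2 + 2), (p.1 - 2, p.2 + 1),
    (p.1 - 1, p.2 - 1), (p.1 + 1, p.2 - 2), (p.1 + 2, p.2 - 1)]

theorem verts_up (x y : ℤ) : (Tri.mk x y true).verts = {(x, y), (x + 1, y), (x, y + 1)} := rfl

theorem verts_down (x y : ℤ) :
    (Tri.mk x y false).verts = {(x + 1, y), (x, y + 1), (x + 1, y + 1)} := rfl

theorem mem_hexagonAt {p : Pt} {t : Tri} : t ∈ hexagonAt p ↔ ∃ k, t = triAt p k := by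
  obtain ⟨x, y, b⟩ := t
  obtain ⟨p, q⟩ := p
  cases b <;>
    simp [hexagonAt, verts_up, verts_down, triAt, Fin.exists_fin_succ, Prod.ext_iff] <;> omega

/-! ### The region `T_a` by linear inequalities -/

theorem up_mem_staircase_right {a : ℕ} {x y : ℤ} :
    Tri.mk x y true ∈ staircase ((a : ℤ), 0) (-1, 1) (0, -1) (a - 1) ↔
      x ≤ a - 1 ∧ x + y ≤ a - 1 ∧ a ≤ 2 * x + y := by
  constructor
  · rintro ⟨i, j, h, hs⟩
    simp [verts_up, Finset.insert_subset_iff, Prod.ext_iff] at hs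
    omega
  · intro h
    -- Each rhombus contains one upward triangle, here the one with x = a - 1 - i and y = i - j;
    -- solve for i and j.
    obtain ⟨i, hi⟩ := Int.eq_ofNat_of_zero_le (show 0 ≤ a - 1 - x by omega)
    obtain ⟨j, hj⟩ := Int.eq_ofNat_of_zero_le (show 0 ≤ a - 1 - x - y by omega)
    refine ⟨i, j, by omega, ?_⟩
    intro p hp
    obtain ⟨p, q⟩ := p
    simp [verts_up, Prod.ext_iff] at hp ⊢
    omega

theorem down_mem_staircase_right {a : ℕ} {x y : ℤ} :
    Tri.mk x y false ∈ staircase ((a : ℤ), 0) (-1, 1) (0, -1) (a - 1) ↔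
      x ≤ a - 1 ∧ x + y ≤ a - 2 ∧ a - 1 ≤ 2 * x + y := by
  constructor
  · rintro ⟨i, j, h, hs⟩
    simp [verts_down, Finset.insert_subset_iff, Prod.ext_iff] at hs
    omega
  · intro h
    obtain ⟨i, hi⟩ := Int.eq_ofNat_of_zero_le (show 0 ≤ a - 1 - x by omega)
    obtain ⟨j, hj⟩ := Int.eq_ofNat_of_zero_le (show 0 ≤ a - 2 - x - y by omega)
    refine ⟨i, j, by omega, ?_⟩
    intro p hp
    obtain ⟨p, q⟩ := p
    simp [verts_down, Prod.ext_iff] at hp ⊢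
    omega

theorem up_mem_staircase_left {a : ℕ} {x y : ℤ} :
    Tri.mk x y true ∈ staircase (-(a : ℤ), (a : ℤ)) (0, -1) (1, 0) (a - 1) ↔
      -a ≤ x ∧ y ≤ a - 1 ∧ a < y - x := by
  constructor
  · rintro ⟨i, j, h, hs⟩
    simp [verts_up, Finset.insert_subset_iff, Prod.ext_iff] at hs
    omega
  · intro h
    obtain ⟨i, hi⟩ := Int.eq_ofNat_of_zero_le (show 0 ≤ a - 1 - y by omega)
    obtain ⟨j, hj⟩ := Int.eq_ofNat_of_zero_le (show 0 ≤ x + a by omega)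
    refine ⟨i, j, by omega, ?_⟩
    intro p hp
    obtain ⟨p, q⟩ := p
    simp [verts_up, Prod.ext_iff] at hp ⊢
    omega

theorem down_mem_staircase_left {a : ℕ} {x y : ℤ} :
    Tri.mk x y false ∈ staircase (-(a : ℤ), (a : ℤ)) (0, -1) (1, 0) (a - 1) ↔
      -a ≤ x ∧ y ≤ a - 1 ∧ a < y - x := by
  constructor
  · rintro ⟨i, j, h, hs⟩
    simp [verts_down, Finset.insert_subset_iff, Prod.ext_iff] at hs
    omega
  · intro h
    obtain ⟨i, hi⟩ := Int.eq_ofNat_of_zero_le (show 0 ≤ a - 1 - y by omega)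
    obtain ⟨j, hj⟩ := Int.eq_ofNat_of_zero_le (show 0 ≤ x + a by omega)
    refine ⟨i, j, by omega, ?_⟩
    intro p hp
    obtain ⟨p, q⟩ := p
    simp [verts_down, Prod.ext_iff] at hp ⊢
    omega

theorem up_mem_staircase_bottom {a : ℕ} {x y : ℤ} :
    Tri.mk x y true ∈ staircase (0, -(a : ℤ)) (1, 0) (-1, 1) (a - 1) ↔
      -a ≤ y ∧ -a ≤ x + y ∧ a + 2 ≤ -x - 2 * y := by
  constructor
  · rintro ⟨i, j, h, hs⟩
    simp [verts_up, Finset.insert_subset_iff, Prod.ext_iff] at hs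
    omega
  · intro h
    obtain ⟨i, hi⟩ := Int.eq_ofNat_of_zero_le (show 0 ≤ x + y + a by omega)
    obtain ⟨j, hj⟩ := Int.eq_ofNat_of_zero_le (show 0 ≤ y + a by omega)
    refine ⟨i, j, by omega, ?_⟩
    intro p hp
    obtain ⟨p, q⟩ := p
    simp [verts_up, Prod.ext_iff] at hp ⊢
    omega

theorem down_mem_staircase_bottom {a : ℕ} {x y : ℤ} :
    Tri.mk x y false ∈ staircase (0, -(a : ℤ)) (1, 0) (-1, 1) (a - 1) ↔
      -a ≤ y ∧ -a - 1 ≤ x + y ∧ a + 3 ≤ -x - 2 * y := by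
  constructor
  · rintro ⟨i, j, h, hs⟩
    simp [verts_down, Finset.insert_subset_iff, Prod.ext_iff] at hs
    omega
  · intro h
    obtain ⟨i, hi⟩ := Int.eq_ofNat_of_zero_le (show 0 ≤ x + y + 1 + a by omega)
    obtain ⟨j, hj⟩ := Int.eq_ofNat_of_zero_le (show 0 ≤ y + a by omega)
    refine ⟨i, j, by omega, ?_⟩
    intro p hp
    obtain ⟨p, q⟩ := p
    simp [verts_down, Prod.ext_iff] at hp ⊢
    omega

/-- The left-hand sides are the three forms at the centroid: each staircase replaces two sides of
the hexagon by one of these bounds. -/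
theorem up_mem_regionT {a : ℕ} {x y : ℤ} :
    Tri.mk x y true ∈ regionT a ↔
      2 * x + y + 1 ≤ a ∧ y - x ≤ a ∧ -x - 2 * y - 1 ≤ a := by
  simp only [regionT, Set.mem_sdiff, Set.mem_union, up_mem_staircase_right, up_mem_staircase_left,
    up_mem_staircase_bottom, hexagonRegion, Set.mem_ofPred_eq, verts_up, Finset.mem_insert,
    Finset.mem_singleton, forall_eq_or_imp, forall_eq, abs_le]
  omega

theorem down_mem_regionT {a : ℕ} {x y : ℤ} :
    Tri.mk x y false ∈ regionT a ↔
      2 * x + y + 2 ≤ a ∧ y - x ≤ a ∧ -x - 2 * y - 2 ≤ a := by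
  simp only [regionT, Set.mem_sdiff, Set.mem_union, down_mem_staircase_right,
    down_mem_staircase_left, down_mem_staircase_bottom, hexagonRegion, Set.mem_ofPred_eq,
    verts_down, Finset.mem_insert, Finset.mem_singleton, forall_eq_or_imp, forall_eq, abs_le]
  omega

theorem hexagonAt_subset_regionT {a : ℕ} {p : Pt} :
    hexagonAt p ⊆ regionT a ↔
      2 * p.1 + p.2 + 1 ≤ a ∧ p.2 - p.1 + 1 ≤ a ∧ -p.1 - 2 * p.2 + 1 ≤ a := by
  have : hexagonAt p ⊆ regionT a ↔ ∀ k, triAt p k ∈ regionT a :=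
    ⟨fun h k => h (mem_hexagonAt.2 ⟨k, rfl⟩), fun h t ht => by
      obtain ⟨k, rfl⟩ := mem_hexagonAt.1 ht
      exact h k⟩
  rw [this]
  simp only [triAt, Fin.forall_fin_succ]
  simp [up_mem_regionT, down_mem_regionT]
  omega

/-- The bounding box in `specialCenters` is redundant: the three inequalities already bound both
coordinates. -/
theorem mem_specialCenters {a : ℕ} {p : Pt} :
    p ∈ specialCenters a ↔
      (2 * p.1 + p.2 + 1 ≤ a ∧ p.2 - p.1 + 1 ≤ a ∧ -p.1 - 2 * p.2 + 1 ≤ a) ∧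
        (p.1 - p.2) % 3 = (1 - (a : ℤ)) % 3 := by
  simp only [specialCenters, Finset.mem_filter, Finset.mem_product, Finset.mem_Icc,
    hexagonAt_subset_regionT, Int.ModEq]
  omega

theorem triAt_mem_regionT {a : ℕ} {p : Pt} (hp : p ∈ specialCenters a) (k : Fin 6) :
    triAt p k ∈ regionT a :=
  hexagonAt_subset_regionT.2 (mem_specialCenters.1 hp).1 (mem_hexagonAt.2 ⟨k, rfl⟩)

theorem triAt_injective (p : Pt) : Function.Injective (triAt p) := by
  intro k l h
  fin_cases k <;> fin_cases l <;> simp [triAt] at h ⊢ <;> omega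

theorem nbr_injective (p : Pt) : Function.Injective (nbr p) := by
  intro k l h
  fin_cases k <;> fin_cases l <;> simp [nbr] at h ⊢ <;> omega

theorem nbr_nbr (p : Pt) (k : Fin 6) : nbr (nbr p k) (k + 3) = p := by
  obtain ⟨x, y⟩ := p
  fin_cases k <;> simp [nbr]

theorem nbr_ne (p : Pt) (k : Fin 6) : nbr p k ≠ p := by
  obtain ⟨x, y⟩ := p
  fin_cases k <;> simp [nbr, Prod.ext_iff]

/-! ### Partition into special hexagons -/

/-- The three vertices of a unit triangle have three different residues of x - y mod 3. -/
theorem eq_of_mem_hexagonAt {p q : Pt} {t : Tri} (h : (p.1 - p.2) % 3 = (q.1 - q.2) % 3)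
    (hp : t ∈ hexagonAt p) (hq : t ∈ hexagonAt q) : p = q := by
  obtain ⟨x, y, b⟩ := t
  obtain ⟨p, p'⟩ := p
  obtain ⟨q, q'⟩ := q
  cases b <;> simp [hexagonAt, verts_up, verts_down, Prod.ext_iff] at hp hq h ⊢ <;> omega

theorem existsUnique_specialCenters {a : ℕ} {t : Tri} (ht : t ∈ regionT a) :
    ∃! p, p ∈ specialCenters a ∧ t ∈ hexagonAt p := by
  refine existsUnique_of_exists_of_unique ?_ fun p q hp hq => eq_of_mem_hexagonAt
    ((mem_specialCenters.1 hp.1).2.trans (mem_specialCenters.1 hq.1).2.symm) hp.2 hq.2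
  obtain ⟨x, y, b⟩ := t
  cases b
  · rw [down_mem_regionT] at ht
    obtain h | h | h : (x - y + 1) % 3 = (1 - (a : ℤ)) % 3 ∨ (x - y - 1) % 3 = (1 - (a : ℤ)) % 3 ∨
      (x - y) % 3 = (1 - (a : ℤ)) % 3 := by omega
    · refine ⟨(x + 1, y), mem_specialCenters.2 ?_, by simp [hexagonAt, verts_down]⟩
      dsimp only
      omega
    · refine ⟨(x, y + 1), mem_specialCenters.2 ?_, by simp [hexagonAt, verts_down]⟩
      dsimp only
      omega
    · refine ⟨(x + 1, y + 1), mem_specialCenters.2 ?_, by simp [hexagonAt, verts_down]⟩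
      dsimp only
      omega
  · rw [up_mem_regionT] at ht
    obtain h | h | h : (x - y + 1) % 3 = (1 - (a : ℤ)) % 3 ∨ (x - y - 1) % 3 = (1 - (a : ℤ)) % 3 ∨
      (x - y) % 3 = (1 - (a : ℤ)) % 3 := by omega
    · refine ⟨(x + 1, y), mem_specialCenters.2 ?_, by simp [hexagonAt, verts_up]⟩
      dsimp only
      omega
    · refine ⟨(x, y + 1), mem_specialCenters.2 ?_, by simp [hexagonAt, verts_up]⟩
      dsimp only
      omega
    · refine ⟨(x, y), mem_specialCenters.2 ?_, by simp [hexagonAt, verts_up]⟩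
      dsimp only
      omega

/-! ### Adjacent triangles and the edges of `t_a` -/

theorem adjacent_comm {s t : Tri} : s.Adjacent t ↔ t.Adjacent s := by
  rw [Tri.Adjacent, Tri.Adjacent, Finset.inter_comm]

theorem card_verts (t : Tri) : t.verts.card = 3 := by
  obtain ⟨x, y, b⟩ := t
  cases b
  · rw [verts_down]
    exact Finset.card_eq_three.2 ⟨_, _, _, by simp, by simp, by simp, rfl⟩
  · rw [verts_up]
    exact Finset.card_eq_three.2 ⟨_, _, _, by simp, by simp, by simp, rfl⟩

theorem Tri.Adjacent.ne {s t : Tri} (h : s.Adjacent t) : s ≠ t := by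
  rintro rfl
  rw [Tri.Adjacent, Finset.inter_self, card_verts] at h
  omega

theorem up_adjacent_down {x y z w : ℤ} :
    (Tri.mk x y true).Adjacent (Tri.mk z w false) ↔
      (z = x ∧ w = y) ∨ (z = x - 1 ∧ w = y) ∨ (z = x ∧ w = y - 1) := by
  constructor
  · intro h
    obtain ⟨⟨p, p'⟩, ⟨q, q'⟩, hne, hpq⟩ := Finset.card_eq_two.1 h
    have hp : (p, p') ∈ (Tri.mk x y true).verts ∩ (Tri.mk z w false).verts := by simp [hpq]
    have hq : (q, q') ∈ (Tri.mk x y true).verts ∩ (Tri.mk z w false).verts := by simp [hpq]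
    simp [verts_up, verts_down, Prod.ext_iff] at hp hq hne
    omega
  · rintro (⟨rfl, rfl⟩ | ⟨rfl, rfl⟩ | ⟨rfl, rfl⟩)
    · refine Finset.card_eq_two.2 ⟨(z + 1, w), (z, w + 1), by simp, ?_⟩
      ext ⟨p, q⟩
      simp [verts_up, verts_down, Prod.ext_iff]
    · refine Finset.card_eq_two.2 ⟨(x, w), (x, w + 1), by simp, ?_⟩
      ext ⟨p, q⟩
      simp [verts_up, verts_down, Prod.ext_iff]
    · refine Finset.card_eq_two.2 ⟨(z + 1, y), (z, y), by simp, ?_⟩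
      ext ⟨p, q⟩
      simp [verts_up, verts_down, Prod.ext_iff]
      omega

theorem Tri.Adjacent.up_ne {s t : Tri} (h : s.Adjacent t) : s.up ≠ t.up := by
  have hst := h.ne
  obtain ⟨x, y, b⟩ := s
  obtain ⟨z, w, c⟩ := t
  obtain ⟨⟨p, p'⟩, ⟨q, q'⟩, hne, hpq⟩ := Finset.card_eq_two.1 h
  have hp : (p, p') ∈ (Tri.mk x y b).verts ∩ (Tri.mk z w c).verts := by simp [hpq]
  have hq : (q, q') ∈ (Tri.mk x y b).verts ∩ (Tri.mk z w c).verts := by simp [hpq]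
  rintro ⟨rfl : b = c⟩
  cases b <;> simp [verts_up, verts_down, Prod.ext_iff] at hp hq hne hst <;> omega

/-- Two triangles around centres of the same colour class are adjacent if they are consecutive
around the same centre or opposite to each other. -/
theorem triAt_adjacent {p q : Pt} (h : (p.1 - p.2) % 3 = (q.1 - q.2) % 3) {k l : Fin 6} :
    (triAt p k).Adjacent (triAt q l) ↔
      (p = q ∧ (l = k + 1 ∨ k = l + 1)) ∨ (q = nbr p k ∧ l = k + 3) := by
  obtain ⟨x, y⟩ := p
  obtain ⟨z, w⟩ := q
  have hud : ∀ x y z w : ℤ, ∀ b, ¬ (Tri.mk x y b).Adjacent (Tri.mk z w b) :=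
    fun x y z w b h => h.up_ne rfl
  dsimp only at h
  fin_cases k <;> fin_cases l <;>
    simp [triAt, nbr, hud, up_adjacent_down, adjacent_comm (s := Tri.mk _ _ false),
      Prod.ext_iff] <;> omega

variable {a : ℕ}

theorem specialCenters_class (v w : specialCenters a) :
    ((v : Pt).1 - (v : Pt).2) % 3 = ((w : Pt).1 - (w : Pt).2) % 3 :=
  (mem_specialCenters.1 v.2).2.trans (mem_specialCenters.1 w.2).2.symm

theorem graphT_adj {v w : specialCenters a} :
    (graphT a).graph.Adj v w ↔ ∃ k, (w : Pt) = nbr v k := by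
  constructor
  · rintro ⟨hne, s, t, hs, ht, h⟩
    obtain ⟨k, hk⟩ := mem_hexagonAt.1 hs
    obtain ⟨l, hl⟩ := mem_hexagonAt.1 ht
    replace h : (s : Tri).Adjacent t := h
    rw [hk, hl, triAt_adjacent (specialCenters_class v w)] at h
    obtain h | h := h
    · exact absurd (Subtype.ext h.1) hne
    · exact ⟨k, h.1⟩
  · rintro ⟨k, hk⟩
    refine ⟨fun h => nbr_ne v k (by rw [← hk, h]), ⟨_, triAt_mem_regionT v.2 k⟩,
      ⟨_, triAt_mem_regionT w.2 (k + 3)⟩, mem_hexagonAt.2 ⟨k, rfl⟩, mem_hexagonAt.2 ⟨k + 3, rfl⟩, ?_⟩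
    exact (triAt_adjacent (specialCenters_class v w)).2 (Or.inr ⟨hk, rfl⟩)

theorem exists_eq_triAt {t : Tri} (ht : t ∈ regionT a) :
    ∃ (v : specialCenters a) (k : Fin 6), t = triAt v k := by
  obtain ⟨p, ⟨hp, htp⟩, -⟩ := existsUnique_specialCenters ht
  obtain ⟨k, hk⟩ := mem_hexagonAt.1 htp
  exact ⟨⟨p, hp⟩, k, hk⟩

theorem triAt_eq_triAt {v w : specialCenters a} {k l : Fin 6} :
    triAt v k = triAt w l ↔ v = w ∧ k = l := by
  refine ⟨fun h => ?_, by rintro ⟨rfl, rfl⟩; rfl⟩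
  obtain rfl : v = w := Subtype.ext (eq_of_mem_hexagonAt (specialCenters_class v w)
    (mem_hexagonAt.2 ⟨k, rfl⟩) (mem_hexagonAt.2 ⟨l, h⟩))
  exact ⟨rfl, triAt_injective _ h⟩

/-! ### Inner and crossing lozenges -/

/-- The lozenges of `T_a`: those inside a special hexagon, and those crossing an edge of `t_a`. -/
def lozenge : (specialCenters a × Fin 6) ⊕ (graphT a).graph.edgeSet → Set Tri
  | .inl x => {triAt x.1 x.2, triAt x.1 (x.2 + 1)}
  | .inr e => {t | ∃ (v w : specialCenters a) (k : Fin 6),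
      (w : Pt) = nbr v k ∧ (e : Sym2 (specialCenters a)) = s(v, w) ∧ t = triAt v k}

theorem triAt_mem_lozenge_inl {v w : specialCenters a} {k l : Fin 6} :
    triAt v k ∈ lozenge (.inl (w, l)) ↔ v = w ∧ (k = l ∨ k = l + 1) := by
  simp only [lozenge, Set.mem_insert_iff, Set.mem_singleton_iff, triAt_eq_triAt]
  tauto

theorem triAt_mem_lozenge_inr {v : specialCenters a} {k : Fin 6} {e : (graphT a).graph.edgeSet} :
    triAt v k ∈ lozenge (.inr e) ↔
      ∃ w : specialCenters a, (w : Pt) = nbr v k ∧ (e : Sym2 (specialCenters a)) = s(v, w) := by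
  constructor
  · rintro ⟨v', w, l, hw, he, h⟩
    obtain ⟨rfl, rfl⟩ := triAt_eq_triAt.1 h
    exact ⟨w, hw, he⟩
  · rintro ⟨w, hw, he⟩
    exact ⟨v, w, k, hw, he, rfl⟩

theorem lozenge_inr {v w : specialCenters a} {k : Fin 6} (hw : (w : Pt) = nbr v k)
    (h : s(v, w) ∈ (graphT a).graph.edgeSet) :
    lozenge (.inr ⟨s(v, w), h⟩) = {triAt v k, triAt w (k + 3)} := by
  have hv : (v : Pt) = nbr w (k + 3) := by rw [hw, nbr_nbr]
  ext t
  constructor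
  · rintro ⟨v', w', l, hw', he, rfl⟩
    obtain ⟨rfl, rfl⟩ | ⟨rfl, rfl⟩ := Sym2.eq_iff.1 he
    · rw [nbr_injective _ (hw.symm.trans hw')]
      exact Or.inl rfl
    · rw [nbr_injective _ (hw'.symm.trans hv)]
      exact Or.inr rfl
  · rintro (rfl | rfl)
    · exact ⟨v, w, k, hw, rfl, rfl⟩
    · exact ⟨w, v, k + 3, hv, Sym2.eq_swap, rfl⟩

theorem exists_edge (e : (graphT a).graph.edgeSet) :
    ∃ (v w : specialCenters a) (k : Fin 6) (h : s(v, w) ∈ (graphT a).graph.edgeSet),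
      (w : Pt) = nbr v k ∧ e = ⟨s(v, w), h⟩ := by
  obtain ⟨e, he⟩ := e
  induction e using Sym2.ind with
  | _ v w =>
    obtain ⟨k, hk⟩ := graphT_adj.1 ((SimpleGraph.mem_edgeSet _).1 he)
    exact ⟨v, w, k, he, hk, rfl⟩

theorem lozenge_injective : Function.Injective (lozenge (a := a)) := by
  have inner_ne_crossing : ∀ (v : specialCenters a) (k : Fin 6) (e : (graphT a).graph.edgeSet),
      lozenge (.inl (v, k)) ≠ lozenge (.inr e) := by
    intro v k e h
    have h₁ : triAt v k ∈ lozenge (.inr e) := h ▸ triAt_mem_lozenge_inl.2 ⟨rfl, Or.inl rfl⟩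
    have h₂ : triAt v (k + 1) ∈ lozenge (.inr e) := h ▸ triAt_mem_lozenge_inl.2 ⟨rfl, Or.inr rfl⟩
    obtain ⟨w, hw, he⟩ := triAt_mem_lozenge_inr.1 h₁
    obtain ⟨w', hw', he'⟩ := triAt_mem_lozenge_inr.1 h₂
    obtain rfl : w = w' := Sym2.congr_right.1 (he.symm.trans he')
    have hk : ∀ k : Fin 6, k ≠ k + 1 := by decide
    exact hk k (nbr_injective _ (hw.symm.trans hw'))
  rintro (⟨v, k⟩ | e) (⟨w, l⟩ | e') h
  · have h₁ : triAt v k ∈ lozenge (.inl (w, l)) := h ▸ triAt_mem_lozenge_inl.2 ⟨rfl, Or.inl rfl⟩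
    have h₂ : triAt v (k + 1) ∈ lozenge (.inl (w, l)) :=
      h ▸ triAt_mem_lozenge_inl.2 ⟨rfl, Or.inr rfl⟩
    obtain ⟨rfl, hk₁⟩ := triAt_mem_lozenge_inl.1 h₁
    obtain ⟨-, hk₂⟩ := triAt_mem_lozenge_inl.1 h₂
    have hkl : ∀ k l : Fin 6, (k = l ∨ k = l + 1) → (k + 1 = l ∨ k + 1 = l + 1) → k = l := by
      decide
    rw [hkl k l hk₁ hk₂]
  · exact absurd h (inner_ne_crossing _ _ _)
  · exact absurd h.symm (inner_ne_crossing _ _ _)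
  · obtain ⟨v, w, k, hvw, hw, rfl⟩ := exists_edge e
    have h₁ : triAt v k ∈ lozenge (.inr e') := h ▸ triAt_mem_lozenge_inr.2 ⟨w, hw, rfl⟩
    obtain ⟨w', hw', he⟩ := triAt_mem_lozenge_inr.1 h₁
    obtain rfl : w = w' := Subtype.ext (hw.trans hw'.symm)
    exact congrArg Sum.inr (Subtype.ext he.symm)

theorem range_lozenge : Set.range (lozenge (a := a)) = {L | IsLozenge L ∧ L ⊆ regionT a} := by
  ext L
  constructor
  · rintro ⟨⟨v, k⟩ | e, rfl⟩
    · refine ⟨⟨triAt v k, triAt v (k + 1), (triAt_adjacent rfl).2 (Or.inl ⟨rfl, Or.inl rfl⟩), rfl⟩,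
        ?_⟩
      rintro t (rfl | rfl) <;> exact triAt_mem_regionT v.2 _
    · obtain ⟨v, w, k, hvw, hw, rfl⟩ := exists_edge e
      rw [lozenge_inr hw]
      refine ⟨⟨_, _, (triAt_adjacent (specialCenters_class v w)).2 (Or.inr ⟨hw, rfl⟩), rfl⟩, ?_⟩
      rintro t (rfl | rfl)
      · exact triAt_mem_regionT v.2 _
      · exact triAt_mem_regionT w.2 _
  · rintro ⟨⟨s, t, hst, rfl⟩, hR⟩
    obtain ⟨v, k, rfl⟩ := exists_eq_triAt (hR (Or.inl rfl))
    obtain ⟨w, l, rfl⟩ := exists_eq_triAt (hR (Or.inr rfl))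
    obtain ⟨hvw, rfl | rfl⟩ | ⟨hw, rfl⟩ := (triAt_adjacent (specialCenters_class v w)).1 hst
    · exact ⟨.inl (v, k), by simp only [lozenge, hvw]⟩
    · exact ⟨.inl (w, l), by simp only [lozenge, hvw, Set.pair_comm]⟩
    · exact ⟨.inr ⟨s(v, w), graphT_adj.2 ⟨k, hw⟩⟩, lozenge_inr hw _⟩

theorem triAt_mem_lozenge {v : specialCenters a} {k : Fin 6}
    {i : (specialCenters a × Fin 6) ⊕ (graphT a).graph.edgeSet} :
    triAt v k ∈ lozenge i ↔ i = .inl (v, k) ∨ i = .inl (v, k - 1) ∨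
      ∃ (w : specialCenters a) (h : s(v, w) ∈ (graphT a).graph.edgeSet),
        (w : Pt) = nbr v k ∧ i = .inr ⟨s(v, w), h⟩ := by
  obtain ⟨w, l⟩ | e := i
  · rw [triAt_mem_lozenge_inl, ← sub_eq_iff_eq_add]
    simp
    grind
  · rw [triAt_mem_lozenge_inr]
    simp only [reduceCtorEq, false_or, Sum.inr.injEq]
    constructor
    · rintro ⟨w, hw, he⟩
      exact ⟨w, he ▸ e.2, hw, Subtype.ext he⟩
    · rintro ⟨w, -, hw, rfl⟩
      exact ⟨w, hw, rfl⟩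

/-! ### Tilings as colourings with local matchings -/

/-- The selection of lozenges given by an edge colouring (crossing lozenges) and by a set of
lozenges in each special hexagon. -/
def selected (A : (graphT a).graph.edgeSet → EdgeColor) (M : specialCenters a → Finset (Fin 6)) :
    Set ((specialCenters a × Fin 6) ⊕ (graphT a).graph.edgeSet) :=
  {i | Sum.elim (fun x => x.2 ∈ M x.1) (fun e => A e = .y) i}

/-- The directions of the edges at `v` with colour `c`. -/
noncomputable def directions (A : (graphT a).graph.edgeSet → EdgeColor) (c : EdgeColor)
    (v : specialCenters a) : Finset (Fin 6) :=
  open Classical in Finset.univ.filter fun k =>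
    ∃ (w : specialCenters a) (h : s(v, w) ∈ (graphT a).graph.edgeSet),
      (w : Pt) = nbr v k ∧ A ⟨s(v, w), h⟩ = c

/-- `M` gives a perfect matching of the six-cycle without the vertices in `S`, where `k ∈ M` stands
for the edge from `k` to `k + 1`. -/
def LocalMatching (S M : Finset (Fin 6)) : Prop :=
  ∀ k, (k ∈ S ∧ k ∉ M ∧ k - 1 ∉ M) ∨ (k ∉ S ∧ k ∈ M ∧ k - 1 ∉ M) ∨ (k ∉ S ∧ k ∉ M ∧ k - 1 ∈ M)

instance (S : Finset (Fin 6)) : DecidablePred (LocalMatching S) := fun M => by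
  unfold LocalMatching
  infer_instance

/-- Used with `i`, `j` the two inner lozenges over a triangle and `Q` describing the crossing one,
which need not exist; the right side then has the shape of `LocalMatching`. -/
theorem existsUnique_and_or {α : Type*} {P Q : α → Prop} {i j : α} (hij : i ≠ j) (hi : ¬ Q i)
    (hj : ¬ Q j) (hQ : ∀ x y, Q x → Q y → x = y) :
    (∃! x, P x ∧ (x = i ∨ x = j ∨ Q x)) ↔
      ((∃ x, Q x ∧ P x) ∧ ¬ P i ∧ ¬ P j) ∨ (¬ (∃ x, Q x ∧ P x) ∧ P i ∧ ¬ P j) ∨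
        (¬ (∃ x, Q x ∧ P x) ∧ ¬ P i ∧ P j) := by
  constructor
  · rintro ⟨x, ⟨hP, rfl | rfl | hx⟩, hu⟩ <;> grind
  · rintro (⟨⟨x, hx, hP⟩, h⟩ | ⟨h, hP, hP'⟩ | ⟨h, hP, hP'⟩)
    · exact ⟨x, by grind, by grind⟩
    · exact ⟨i, by grind, by grind⟩
    · exact ⟨j, by grind, by grind⟩

theorem existsUnique_selected {A : (graphT a).graph.edgeSet → EdgeColor}
    {M : specialCenters a → Finset (Fin 6)} {v : specialCenters a} :
    (∀ k, ∃! i, i ∈ selected A M ∧ triAt v k ∈ lozenge i) ↔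
      LocalMatching (directions A .y v) (M v) := by
  refine forall_congr' fun k => ?_
  simp only [triAt_mem_lozenge]
  rw [existsUnique_and_or]
  · simp only [selected, directions, Set.mem_ofPred_eq, Sum.elim_inl, Finset.mem_filter,
      Finset.mem_univ, true_and]
    have : (∃ x, (∃ (w : specialCenters a) (h : s(v, w) ∈ (graphT a).graph.edgeSet),
          (w : Pt) = nbr v k ∧ x = Sum.inr ⟨s(v, w), h⟩) ∧
          Sum.elim (fun x : specialCenters a × Fin 6 => x.2 ∈ M x.1) (fun e => A e = .y) x) ↔
        ∃ (w : specialCenters a) (h : s(v, w) ∈ (graphT a).graph.edgeSet),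
          (w : Pt) = nbr v k ∧ A ⟨s(v, w), h⟩ = .y := by
      constructor
      · rintro ⟨_, ⟨w, h, hw, rfl⟩, hA⟩
        exact ⟨w, h, hw, hA⟩
      · rintro ⟨w, h, hw, hA⟩
        exact ⟨_, ⟨w, h, hw, rfl⟩, hA⟩
    rw [this]
  · have : ∀ k : Fin 6, k ≠ k - 1 := by decide
    simpa using this k
  · simp
  · simp
  · rintro _ _ ⟨w, h, hw, rfl⟩ ⟨w', h', hw', rfl⟩
    obtain rfl : w = w' := Subtype.ext (hw.trans hw'.symm)
    rfl

theorem isLozengeTiling_image {X : Set ((specialCenters a × Fin 6) ⊕ (graphT a).graph.edgeSet)} :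
    IsLozengeTiling (regionT a) (lozenge '' X) ↔
      ∀ v k, ∃! i, i ∈ X ∧ triAt (v : specialCenters a) k ∈ lozenge i := by
  have key : ∀ t, (∃! L, L ∈ lozenge '' X ∧ t ∈ L) ↔ ∃! i, i ∈ X ∧ t ∈ lozenge i := by
    intro t
    constructor
    · rintro ⟨_, ⟨⟨i, hi, rfl⟩, ht⟩, hu⟩
      exact ⟨i, ⟨hi, ht⟩, fun j hj => lozenge_injective (hu _ ⟨⟨j, hj.1, rfl⟩, hj.2⟩)⟩
    · rintro ⟨i, ⟨hi, ht⟩, hu⟩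
      refine ⟨_, ⟨⟨i, hi, rfl⟩, ht⟩, ?_⟩
      rintro _ ⟨⟨j, hj, rfl⟩, htj⟩
      rw [hu j ⟨hj, htj⟩]
  constructor
  · rintro ⟨-, h⟩ v k
    exact (key _).1 (h _ (triAt_mem_regionT v.2 k))
  · refine fun h => ⟨?_, fun t ht => ?_⟩
    · rintro _ ⟨i, -, rfl⟩
      exact range_lozenge.subset ⟨i, rfl⟩
    · obtain ⟨v, k, rfl⟩ := exists_eq_triAt ht
      exact (key _).2 (h v k)

theorem numLozengeTilings_eq_card : numLozengeTilings (regionT a) =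
    Nat.card {x : ((graphT a).graph.edgeSet → EdgeColor) × (specialCenters a → Finset (Fin 6)) //
      ∀ v, LocalMatching (directions x.1 .y v) (x.2 v)} := by
  symm
  refine Nat.card_eq_of_bijective (fun x => ⟨lozenge '' selected x.1.1 x.1.2,
    isLozengeTiling_image.2 fun v => existsUnique_selected.2 (x.2 v)⟩) ⟨?_, ?_⟩
  · rintro ⟨⟨A, M⟩, h⟩ ⟨⟨A', M'⟩, h'⟩ heq
    have hs : selected A M = selected A' M' :=
      Set.image_injective.2 lozenge_injective (congrArg Subtype.val heq)
    have hM : M = M' := by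
      ext v k
      exact Set.ext_iff.1 hs (.inl (v, k))
    have hA : A = A' := by
      ext e
      have he : A e = .y ↔ A' e = .y := Set.ext_iff.1 hs (.inr e)
      cases h₁ : A e <;> cases h₂ : A' e <;> simp_all
    subst hM hA
    rfl
  · rintro ⟨𝒯, h𝒯⟩
    classical
    let X := lozenge (a := a) ⁻¹' 𝒯
    have hX : lozenge '' X = 𝒯 := Set.image_preimage_eq_of_subset fun L hL =>
      range_lozenge.symm.subset (h𝒯.1 L hL)
    let A : (graphT a).graph.edgeSet → EdgeColor := fun e => if .inr e ∈ X then .y else .n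
    let M : specialCenters a → Finset (Fin 6) := fun v => Finset.univ.filter fun k => .inl (v, k) ∈ X
    have hs : selected A M = X := by
      ext (⟨v, k⟩ | e)
      · simp [selected, M]
      · simp [selected, A]
    refine ⟨⟨(A, M), fun v => ?_⟩, Subtype.ext ?_⟩
    · rw [← existsUnique_selected, hs]
      rw [← hX] at h𝒯
      exact isLozengeTiling_image.1 h𝒯 v
    · dsimp only
      rw [hs, hX]

open Classical in
-- Once the crossing lozenges are fixed, the hexagons are matched independently of each other.
theorem numLozengeTilings_eq_sum : numLozengeTilings (regionT a) =
    ∑ A : (graphT a).graph.edgeSet → EdgeColor,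
      ∏ v, Nat.card {M // LocalMatching (directions A .y v) M} := by
  rw [numLozengeTilings_eq_card, Nat.card_congr (Equiv.subtypeProdEquivSigmaSubtype
    fun (A : (graphT a).graph.edgeSet → EdgeColor) (M : specialCenters a → Finset (Fin 6)) =>
      ∀ v, LocalMatching (directions A .y v) (M v)), Nat.card_sigma]
  refine Finset.sum_congr rfl fun A _ => ?_
  rw [← Nat.card_pi]
  exact Nat.card_congr Equiv.subtypePiEquivPi

/-! ### Cyclic combinatorics of six directions -/

/-- Turning counterclockwise from direction `k`, one meets `j` strictly before `l`. -/
def DirBetween (k j l : Fin 6) : Prop := 0 < j - k ∧ j - k < l - k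

instance (k j l : Fin 6) : Decidable (DirBetween k j l) := by unfold DirBetween; infer_instance

/-- Two distinct directions in `E` that are consecutive in the cyclic order of `E`. -/
def DirConsecutive (E : Finset (Fin 6)) (k l : Fin 6) : Prop :=
  k ∈ E ∧ l ∈ E ∧ k ≠ l ∧ ((∀ j ∈ E, ¬ DirBetween k j l) ∨ (∀ j ∈ E, ¬ DirBetween l j k))

instance (E : Finset (Fin 6)) (k l : Fin 6) : Decidable (DirConsecutive E k l) := by
  unfold DirConsecutive; infer_instance

/-- The sets of three alternate pairs of neighbouring directions. -/
def PairedDirections (E : Finset (Fin 6)) : Prop :=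
  (5 ∈ E ↔ 0 ∈ E) ∧ (1 ∈ E ↔ 2 ∈ E) ∧ (3 ∈ E ↔ 4 ∈ E)

instance (E : Finset (Fin 6)) : Decidable (PairedDirections E) := by
  unfold PairedDirections; infer_instance

/-- The next direction of `E` after `k`, if the directions of `E` come in pairs. -/
def nextDir (E : Finset (Fin 6)) (k : Fin 6) : Fin 6 :=
  if k + 1 ∈ E then k + 1 else if k + 3 ∈ E then k + 3 else k + 5

/-- The directions of `N` are partitioned into pairs `{k, nextDir E k}`. -/
def DirPairing (E N : Finset (Fin 6)) : Prop :=
  ∃ M ∈ E.powerset, (∀ k ∈ M, ∀ l ∈ M, ({k, nextDir E k} : Finset (Fin 6)) = {l, nextDir E l} ∨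
    Disjoint ({k, nextDir E k} : Finset (Fin 6)) {l, nextDir E l}) ∧
      M.biUnion (fun k => {k, nextDir E k}) = N

instance (E N : Finset (Fin 6)) : Decidable (DirPairing E N) := by
  unfold DirPairing; infer_instance

/-- If `k + 1` is missing, its partner is `k + 2`, as `k` is present; if `k + 3` is missing too, so
is `k + 4`, and only `k + 5`, the partner of `k`, remains. So `nextDir` need not test `k + 2`, `k +
4` or `k + 5`. -/
theorem dirConsecutive_nextDir : ∀ E : Finset (Fin 6), PairedDirections E → ∀ k ∈ E,
    DirConsecutive E k (nextDir E k) := by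
  decide +kernel

/-- The alternatives say which of the two sectors is empty. -/
theorem eq_nextDir_of_dirConsecutive : ∀ E : Finset (Fin 6), PairedDirections E → ∀ k l,
    DirConsecutive E k l → l = nextDir E k ∨ k = nextDir E l := by
  decide +kernel

/-- The gap parity argument, checked over all cases: missing directions fill gaps in twos, so even
gaps mean that the n-directions pair off. Two matchings arise only from the whole six-cycle. -/
theorem card_filter_localMatching : ∀ E : Finset (Fin 6), PairedDirections E →
    ∀ N ∈ E.powerset, (Finset.univ.filter (LocalMatching (E \ N))).card =
      if DirPairing E N then (if N = E then 2 else 1) else 0 := by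
  decide +kernel

/-! ### Angles of the edges -/

theorem toPlane_nbr_sub (p : Pt) (k : Fin 6) : (nbr p k).toPlane - p.toPlane =
    (1 + Complex.exp ((Real.pi / 3 : ℝ) * Complex.I)) *
      Complex.exp ((((k : ℕ) : ℝ) * (Real.pi / 3) : ℝ) * Complex.I) := by
  have hexp : Complex.exp ((((k : ℕ) : ℝ) * (Real.pi / 3) : ℝ) * Complex.I) =
      Complex.exp ((Real.pi / 3 : ℝ) * Complex.I) ^ (k : ℕ) := by
    rw [← Complex.exp_nat_mul]
    push_cast
    ring_nf
  rw [hexp, Pt.toPlane, Pt.toPlane]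
  -- The multipliers of this relation below are the quotients on division by ω² - ω + 1.
  have hω : Complex.exp ((Real.pi / 3 : ℝ) * Complex.I) ^ 2 =
      Complex.exp ((Real.pi / 3 : ℝ) * Complex.I) - 1 := by
    have h3 : (√3 : ℂ) ^ 2 = 3 := by
      rw [← Complex.ofReal_pow, Real.sq_sqrt (by norm_num)]
      norm_num
    rw [Complex.exp_mul_I, ← Complex.ofReal_cos, ← Complex.ofReal_sin, Real.cos_pi_div_three,
      Real.sin_pi_div_three]
    push_cast
    linear_combination (1 / 4 : ℂ) * Complex.I ^ 2 * h3 + (3 / 4 : ℂ) * Complex.I_sq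
  generalize Complex.exp ((Real.pi / 3 : ℝ) * Complex.I) = ω at hω
  fin_cases k <;> simp [nbr]
  · ring
  · linear_combination -hω
  · linear_combination (-ω - 2) * hω
  · linear_combination (-ω ^ 2 - 2 * ω - 1) * hω
  · linear_combination (-ω ^ 3 - 2 * ω ^ 2 - ω + 1) * hω
  · linear_combination (-ω ^ 4 - 2 * ω ^ 3 - ω ^ 2 + ω + 2) * hω

theorem one_add_exp_ne_zero : 1 + Complex.exp ((Real.pi / 3 : ℝ) * Complex.I) ≠ 0 := by
  intro h
  have := congrArg Complex.re h
  rw [Complex.add_re, Complex.exp_ofReal_mul_I_re, Real.cos_pi_div_three] at this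
  norm_num at this

/-- Norms give `r = 1`; then θ is an integer multiple of π/3 congruent to `j - k` mod 6, and the
range of θ selects the representative that subtraction in `Fin 6` gives. -/
theorem direction_eq {j k : Fin 6} {r θ : ℝ} (hr : 0 < r) (h0 : 0 < θ) (h2 : θ < 2 * Real.pi)
    (h : Complex.exp ((((j : ℕ) : ℝ) * (Real.pi / 3) : ℝ) * Complex.I) =
      r * Complex.exp (θ * Complex.I) *
        Complex.exp ((((k : ℕ) : ℝ) * (Real.pi / 3) : ℝ) * Complex.I)) :
    0 < j - k ∧ θ = ((j - k : Fin 6) : ℕ) * (Real.pi / 3) := by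
  have hr1 : r = 1 := by
    have := congrArg norm h
    rw [norm_mul, norm_mul, Complex.norm_exp_ofReal_mul_I, Complex.norm_exp_ofReal_mul_I,
      Complex.norm_exp_ofReal_mul_I, Complex.norm_real, Real.norm_of_nonneg hr.le] at this
    linarith
  rw [hr1, Complex.ofReal_one, one_mul, ← Complex.exp_add] at h
  obtain ⟨n, hn⟩ := Complex.exp_eq_exp_iff_exists_int.1 h
  have hn' : ((j : ℕ) : ℝ) * (Real.pi / 3) = θ + ((k : ℕ) : ℝ) * (Real.pi / 3) +
      n * (2 * Real.pi) := by
    have := congrArg Complex.im hn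
    simpa using this
  have hθ : θ = ((((j : ℕ) : ℤ) - ((k : ℕ) : ℤ) - 6 * n : ℤ) : ℝ) * (Real.pi / 3) := by
    push_cast
    linarith
  have hpi := Real.pi_pos
  have hm0 : 0 < ((j : ℕ) : ℤ) - ((k : ℕ) : ℤ) - 6 * n := by
    rw [hθ] at h0
    exact_mod_cast (pos_of_mul_pos_left h0 (by positivity) : (0 : ℝ) < _)
  have hm6 : ((j : ℕ) : ℤ) - ((k : ℕ) : ℤ) - 6 * n < 6 := by
    rw [hθ] at h2
    have : ((((j : ℕ) : ℤ) - ((k : ℕ) : ℤ) - 6 * n : ℤ) : ℝ) < 6 := by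
      by_contra! h6
      nlinarith
    exact_mod_cast this
  have hval : (((j - k : Fin 6) : ℕ) : ℤ) = ((j : ℕ) : ℤ) - ((k : ℕ) : ℤ) - 6 * n := by
    rw [Fin.val_sub]
    omega
  constructor
  · rw [Fin.lt_def]
    simp only [Fin.val_zero]
    omega
  · rw [hθ, ← hval]
    simp

theorem exp_direction_sub (j k : Fin 6) :
    Complex.exp ((((j : ℕ) : ℝ) * (Real.pi / 3) : ℝ) * Complex.I) =
      Complex.exp (((((j - k : Fin 6) : ℕ) : ℝ) * (Real.pi / 3) : ℝ) * Complex.I) *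
        Complex.exp ((((k : ℕ) : ℝ) * (Real.pi / 3) : ℝ) * Complex.I) := by
  rw [← Complex.exp_add, Complex.exp_eq_exp_iff_exists_int]
  obtain ⟨n, hn⟩ : ∃ n : ℤ, ((j : ℕ) : ℤ) = ((j - k : Fin 6) : ℕ) + ((k : ℕ) : ℤ) + 6 * n := by
    rw [Fin.val_sub]
    exact ⟨(((j : ℕ) : ℤ) - ((6 - (k : ℕ) + (j : ℕ)) % 6 : ℕ) - (k : ℕ)) / 6, by omega⟩
  have hn' : ((j : ℕ) : ℂ) = ((j - k : Fin 6) : ℕ) + ((k : ℕ) : ℂ) + 6 * n := by exact_mod_cast hn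
  refine ⟨n, ?_⟩
  push_cast
  rw [hn']
  ring

theorem ccwBetween_iff {v w u w' : specialCenters a} {k j l : Fin 6} (hw : (w : Pt) = nbr v k)
    (hu : (u : Pt) = nbr v j) (hw' : (w' : Pt) = nbr v l) :
    (graphT a).CcwBetween v w u w' ↔ DirBetween k j l := by
  have key : ∀ (z : specialCenters a) (m : Fin 6), (z : Pt) = nbr v m →
      ∀ r θ : ℝ, (graphT a).pos z - (graphT a).pos v =
        r * Complex.exp (θ * Complex.I) * ((graphT a).pos w - (graphT a).pos v) ↔
      Complex.exp ((((m : ℕ) : ℝ) * (Real.pi / 3) : ℝ) * Complex.I) =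
        r * Complex.exp (θ * Complex.I) *
          Complex.exp ((((k : ℕ) : ℝ) * (Real.pi / 3) : ℝ) * Complex.I) := by
    intro z m hz r θ
    simp only [graphT, hz, hw, toPlane_nbr_sub]
    rw [mul_left_comm]
    exact mul_right_inj' one_add_exp_ne_zero
  have hpi := Real.pi_pos
  constructor
  · rintro ⟨r₁, r₂, θ₁, θ₂, hr₁, hr₂, h0, h12, h2, e₁, e₂⟩
    obtain ⟨hj, hθ₁⟩ := direction_eq hr₁ h0 (h12.trans h2) ((key u j hu r₁ θ₁).1 e₁)
    obtain ⟨-, hθ₂⟩ := direction_eq hr₂ (h0.trans h12) h2 ((key w' l hw' r₂ θ₂).1 e₂)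
    refine ⟨hj, ?_⟩
    rw [hθ₁, hθ₂] at h12
    exact_mod_cast lt_of_mul_lt_mul_right h12 (by positivity)
  · rintro ⟨hj, hl⟩
    have hj' : (0 : ℝ) < ((j - k : Fin 6) : ℕ) := by exact_mod_cast hj
    have hl' : (((j - k : Fin 6) : ℕ) : ℝ) < ((l - k : Fin 6) : ℕ) := by exact_mod_cast hl
    have hl6 : (((l - k : Fin 6) : ℕ) : ℝ) < 6 := by exact_mod_cast (l - k).isLt
    refine ⟨1, 1, ((j - k : Fin 6) : ℕ) * (Real.pi / 3), ((l - k : Fin 6) : ℕ) * (Real.pi / 3),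
      one_pos, one_pos, by positivity, by gcongr, by nlinarith, (key u j hu _ _).2 ?_,
      (key w' l hw' _ _).2 ?_⟩
    · rw [Complex.ofReal_one, one_mul]
      exact exp_direction_sub j k
    · rw [Complex.ofReal_one, one_mul]
      exact exp_direction_sub l k

/-! ### The Lucas condition in terms of directions -/

/-- The directions of the edges of `t_a` at `v`. -/
noncomputable def edgeDirections (v : specialCenters a) : Finset (Fin 6) :=
  Finset.univ.filter fun k => nbr v k ∈ specialCenters a

theorem mem_edgeDirections {v : specialCenters a} {k : Fin 6} :
    k ∈ edgeDirections v ↔ nbr v k ∈ specialCenters a := by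
  simp [edgeDirections]

theorem mem_edgeDirections_of_eq {v w : specialCenters a} {k : Fin 6} (h : (w : Pt) = nbr v k) :
    k ∈ edgeDirections v :=
  mem_edgeDirections.2 (h ▸ w.2)

/-- Each form is raised by exactly two neighbouring directions, by 3 each: 2x+y by 5 and 0, y-x by 1
and 2, -x-2y by 3 and 4. Both neighbours of a pair therefore leave the region by the same
inequality. -/
theorem pairedDirections_edgeDirections (v : specialCenters a) :
    PairedDirections (edgeDirections v) := by
  obtain ⟨⟨x, y⟩, h⟩ := v
  simp only [PairedDirections, mem_edgeDirections, mem_specialCenters] at h ⊢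
  simp [nbr]
  omega

theorem consecutive_iff {v w w' : specialCenters a} {k l : Fin 6} (hw : (w : Pt) = nbr v k)
    (hw' : (w' : Pt) = nbr v l) :
    (graphT a).Consecutive v w w' ↔ DirConsecutive (edgeDirections v) k l := by
  have between : ∀ {w w' : specialCenters a} {k l : Fin 6}, (w : Pt) = nbr v k →
      (w' : Pt) = nbr v l →
      ((∀ u, (graphT a).graph.Adj v u → ¬ (graphT a).CcwBetween v w u w') ↔
        ∀ j ∈ edgeDirections v, ¬ DirBetween k j l) := by
    intro w w' k l hw hw'
    constructor
    · intro h j hj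
      rw [← ccwBetween_iff hw (u := ⟨_, mem_edgeDirections.1 hj⟩) rfl hw']
      exact h _ (graphT_adj.2 ⟨j, rfl⟩)
    · intro h u hu
      obtain ⟨j, hj⟩ := graphT_adj.1 hu
      rw [ccwBetween_iff hw hj hw']
      exact h j (mem_edgeDirections_of_eq hj)
  have hne : w ≠ w' ↔ k ≠ l := by
    rw [Ne, Ne, ← Subtype.coe_inj, hw, hw', (nbr_injective _).eq_iff]
  rw [Drawing.Consecutive, DirConsecutive, between hw hw', between hw' hw, hne,
    iff_true_intro (graphT_adj.2 ⟨k, hw⟩), iff_true_intro (graphT_adj.2 ⟨l, hw'⟩),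
    iff_true_intro (mem_edgeDirections_of_eq hw), iff_true_intro (mem_edgeDirections_of_eq hw')]

/-- The neighbours of `v` in the directions of `F`. -/
def nbrSet (v : specialCenters a) (F : Finset (Fin 6)) : Set (specialCenters a) :=
  {w | ∃ k ∈ F, (w : Pt) = nbr v k}

theorem mem_nbrSet {v w : specialCenters a} {F : Finset (Fin 6)} {k : Fin 6}
    (hw : (w : Pt) = nbr v k) : w ∈ nbrSet v F ↔ k ∈ F := by
  constructor
  · rintro ⟨l, hl, h⟩
    rwa [nbr_injective _ (hw.symm.trans h)]
  · exact fun h => ⟨k, h, hw⟩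

theorem nbrSet_pair {v w w' : specialCenters a} {k l : Fin 6} (hw : (w : Pt) = nbr v k)
    (hw' : (w' : Pt) = nbr v l) : nbrSet v {k, l} = {w, w'} := by
  ext u
  simp only [nbrSet, Finset.mem_insert, Finset.mem_singleton, exists_eq_or_imp, exists_eq_left,
    ← hw, ← hw', Set.mem_ofPred_eq, Subtype.coe_inj, Set.mem_insert_iff, Set.mem_singleton_iff]

theorem mem_directions {A : (graphT a).graph.edgeSet → EdgeColor} {c : EdgeColor}
    {v : specialCenters a} {k : Fin 6} : k ∈ directions A c v ↔
      ∃ (w : specialCenters a) (h : s(v, w) ∈ (graphT a).graph.edgeSet),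
        (w : Pt) = nbr v k ∧ A ⟨s(v, w), h⟩ = c := by
  simp only [directions, Finset.mem_filter, Finset.mem_univ, true_and]

theorem nNeighbors_eq_nbrSet (A : (graphT a).graph.edgeSet → EdgeColor) (v : specialCenters a) :
    (graphT a).nNeighbors A v = nbrSet v (directions A .n v) := by
  ext w
  constructor
  · rintro ⟨h, hA⟩
    obtain ⟨k, hk⟩ := graphT_adj.1 h
    exact ⟨k, mem_directions.2 ⟨w, h, hk, hA⟩, hk⟩
  · rintro ⟨k, hk, hw⟩
    obtain ⟨w', h, hw', hA⟩ := mem_directions.1 hk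
    obtain rfl : w = w' := Subtype.ext (hw.trans hw'.symm)
    exact ⟨h, hA⟩

theorem directions_subset (A : (graphT a).graph.edgeSet → EdgeColor) (c : EdgeColor)
    (v : specialCenters a) : directions A c v ⊆ edgeDirections v := by
  intro k hk
  obtain ⟨w, -, hw, -⟩ := mem_directions.1 hk
  exact mem_edgeDirections_of_eq hw

theorem directions_y (A : (graphT a).graph.edgeSet → EdgeColor) (v : specialCenters a) :
    directions A .y v = edgeDirections v \ directions A .n v := by
  have mem : ∀ c k (w : specialCenters a) (hw : (w : Pt) = nbr v k),
      k ∈ directions A c v ↔ A ⟨s(v, w), graphT_adj.2 ⟨k, hw⟩⟩ = c := by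
    intro c k w hw
    rw [mem_directions]
    constructor
    · rintro ⟨w', h, hw', hA⟩
      obtain rfl : w = w' := Subtype.ext (hw.trans hw'.symm)
      exact hA
    · exact fun hA => ⟨w, _, hw, hA⟩
  ext k
  by_cases hk : k ∈ edgeDirections v
  · have hw : ((⟨nbr v k, mem_edgeDirections.1 hk⟩ : specialCenters a) : Pt) = nbr v k := rfl
    rw [Finset.mem_sdiff, mem _ _ _ hw, mem _ _ _ hw]
    simp only [hk, true_and]
    generalize A _ = c
    cases c <;> simp
  · exact iff_of_false (fun h => hk (directions_subset _ _ _ h))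
      fun h => hk (Finset.mem_sdiff.1 h).1

theorem directions_n_eq_iff (A : (graphT a).graph.edgeSet → EdgeColor) (v : specialCenters a) :
    directions A .n v = edgeDirections v ↔
      ∀ e : (graphT a).graph.edgeSet, v ∈ (e : Sym2 (specialCenters a)) → A e = .n := by
  constructor
  · rintro h ⟨e, he⟩ hv
    obtain ⟨w, rfl⟩ := Sym2.mem_iff_exists.1 hv
    obtain ⟨k, hk⟩ := graphT_adj.1 ((SimpleGraph.mem_edgeSet _).1 he)
    have hw : w ∈ (graphT a).nNeighbors A v := by
      rw [nNeighbors_eq_nbrSet, mem_nbrSet hk, h]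
      exact mem_edgeDirections_of_eq hk
    exact hw.2
  · refine fun h => (directions_subset _ _ _).antisymm fun k hk => ?_
    exact mem_directions.2 ⟨⟨nbr v k, mem_edgeDirections.1 hk⟩,
      graphT_adj.2 ⟨k, rfl⟩, rfl, h _ (Sym2.mem_mk_left _ _)⟩

/-- Every consecutive pair is some `{k, nextDir E k}`, so an arbitrary partition is recorded by a
set of starting directions, which makes the condition decidable. -/
theorem exists_consecutive_pairs_iff (A : (graphT a).graph.edgeSet → EdgeColor)
    (v : specialCenters a) :
    (∃ P : Set (Set (specialCenters a)), P.PairwiseDisjoint id ∧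
      ⋃₀ P = (graphT a).nNeighbors A v ∧
        ∀ S ∈ P, ∃ w w', (graphT a).Consecutive v w w' ∧ S = {w, w'}) ↔
      DirPairing (edgeDirections v) (directions A .n v) := by
  classical
  have hE := pairedDirections_edgeDirections v
  set E := edgeDirections v with hEdef
  rw [nNeighbors_eq_nbrSet]
  set N := directions A .n v with hN
  have pairSubset : ∀ k ∈ E, ({k, nextDir E k} : Finset (Fin 6)) ⊆ E := by
    intro k hk
    simp [Finset.insert_subset_iff, hk, (dirConsecutive_nextDir E hE k hk).2.1]
  constructor
  · rintro ⟨P, hdis, hP, hpair⟩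
    refine ⟨E.filter fun k => nbrSet v {k, nextDir E k} ∈ P,
      Finset.mem_powerset.2 (Finset.filter_subset _ _), fun k hk l hl => ?_, ?_⟩
    · obtain ⟨hkE, hkP⟩ := Finset.mem_filter.1 hk
      obtain ⟨hlE, hlP⟩ := Finset.mem_filter.1 hl
      by_cases hkl : nbrSet v {k, nextDir E k} = nbrSet v {l, nextDir E l}
      · left
        ext j
        -- `nbrSet` sees only directions in `E`, so equality of neighbour sets gives nothing outside
        -- `E`.
        by_cases hj : j ∈ E
        · have hw : ((⟨nbr v j, mem_edgeDirections.1 hj⟩ : specialCenters a) : Pt) = nbr v j := rfl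
          rw [← mem_nbrSet hw, hkl, mem_nbrSet hw]
        · exact iff_of_false (fun h => hj (pairSubset k hkE h)) fun h => hj (pairSubset l hlE h)
      · right
        refine Finset.disjoint_left.2 fun j hjk hjl => ?_
        have hw : ((⟨nbr v j, mem_edgeDirections.1 (pairSubset k hkE hjk)⟩ :
          specialCenters a) : Pt) = nbr v j := rfl
        exact Set.disjoint_left.1 (hdis hkP hlP hkl) ((mem_nbrSet hw).2 hjk) ((mem_nbrSet hw).2 hjl)
    · ext j
      simp only [Finset.mem_biUnion]
      constructor
      · rintro ⟨k, hk, hj⟩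
        obtain ⟨hkE, hkP⟩ := Finset.mem_filter.1 hk
        have hw : ((⟨nbr v j, mem_edgeDirections.1 (pairSubset k hkE hj)⟩ :
          specialCenters a) : Pt) = nbr v j := rfl
        rw [← mem_nbrSet hw, ← hP]
        exact ⟨_, hkP, (mem_nbrSet hw).2 hj⟩
      · intro hj
        have hw : ((⟨nbr v j, mem_edgeDirections.1 (directions_subset _ _ _ hj)⟩ :
          specialCenters a) : Pt) = nbr v j := rfl
        obtain ⟨S, hS, hjS⟩ := hP.superset ((mem_nbrSet hw).2 hj)
        obtain ⟨w, w', hc, rfl⟩ := hpair S hS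
        obtain ⟨k, hk⟩ := graphT_adj.1 hc.1
        obtain ⟨l, hl⟩ := graphT_adj.1 hc.2.1
        have hkl : nbrSet v {k, l} = {w, w'} := nbrSet_pair hk hl
        have hj' : j ∈ ({k, l} : Finset (Fin 6)) := by rwa [← mem_nbrSet hw, hkl]
        obtain rfl | rfl := eq_nextDir_of_dirConsecutive E hE k l ((consecutive_iff hk hl).1 hc)
        · exact ⟨k, Finset.mem_filter.2 ⟨mem_edgeDirections_of_eq hk, hkl ▸ hS⟩, hj'⟩
        · rw [Finset.pair_comm] at hkl hj'
          exact ⟨l, Finset.mem_filter.2 ⟨mem_edgeDirections_of_eq hl, hkl ▸ hS⟩, hj'⟩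
  · rintro ⟨M, hME, hdis, hM⟩
    rw [Finset.mem_powerset] at hME
    refine ⟨(fun k => nbrSet v {k, nextDir E k}) '' M, ?_, ?_, ?_⟩
    · rintro _ ⟨k, hk, rfl⟩ _ ⟨l, hl, rfl⟩ hne
      obtain h | h := hdis k hk l hl
      · exact absurd (by dsimp only; rw [h]) hne
      · refine Set.disjoint_left.2 ?_
        rintro w ⟨j, hj, hw⟩ hw'
        exact Finset.disjoint_left.1 h hj ((mem_nbrSet hw).1 hw')
    · rw [← hM]
      ext w
      simp only [Set.sUnion_image, Set.mem_iUnion, nbrSet, Finset.mem_biUnion, Set.mem_ofPred_eq,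
        Finset.mem_coe]
      grind
    · rintro _ ⟨k, hk, rfl⟩
      have hc := dirConsecutive_nextDir E hE k (hME hk)
      have hw : ((⟨nbr v k, mem_edgeDirections.1 hc.1⟩ : specialCenters a) : Pt) = nbr v k := rfl
      have hw' : ((⟨nbr v (nextDir E k), mem_edgeDirections.1 hc.2.1⟩ : specialCenters a) : Pt) =
        nbr v (nextDir E k) := rfl
      exact ⟨_, _, (consecutive_iff hw hw').2 hc, nbrSet_pair hw hw'⟩

/-! ### From local counts to the formula -/

open Classical in
theorem card_localMatching (A : (graphT a).graph.edgeSet → EdgeColor) (v : specialCenters a) :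
    Nat.card {M // LocalMatching (directions A .y v) M} =
      if DirPairing (edgeDirections v) (directions A .n v) then
        (if ∀ e : (graphT a).graph.edgeSet, v ∈ (e : Sym2 (specialCenters a)) → A e = .n
          then 2 else 1) else 0 := by
  have h := card_filter_localMatching _ (pairedDirections_edgeDirections v) (directions A .n v)
    (Finset.mem_powerset.2 (directions_subset A .n v))
  simp only [directions_n_eq_iff] at h
  rw [directions_y, Nat.card_eq_fintype_card, Fintype.card_subtype]
  convert h

theorem numLozengeTilings_eq_sum_Luc :
    numLozengeTilings (regionT a) = ∑ A ∈ (graphT a).Luc, 2 ^ (graphT a).Sp A := by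
  classical
  rw [numLozengeTilings_eq_sum]
  have hLuc : (graphT a).Luc = Finset.univ.filter fun A =>
      ∀ v, DirPairing (edgeDirections v) (directions A .n v) := by
    ext A
    simp only [Drawing.Luc, Set.Finite.mem_toFinset, Set.mem_ofPred_eq, Drawing.IsLucasColoring,
      Finset.mem_filter, Finset.mem_univ, true_and]
    exact forall_congr' fun v => exists_consecutive_pairs_iff A v
  rw [hLuc, Finset.sum_filter]
  refine Finset.sum_congr (by ext; simp) fun A _ => ?_
  simp only [card_localMatching]
  -- One vertex that violates the Lucas condition makes the product vanish; otherwise each special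
  -- vertex contributes a factor 2.
  rw [Finset.prod_ite_zero]
  simp only [Finset.mem_univ, true_imp_iff]
  refine if_congr Iff.rfl ?_ rfl
  rw [Finset.prod_ite, Finset.prod_const, Finset.prod_const_one, mul_one, Drawing.Sp,
    Nat.card_eq_fintype_card, Fintype.card_subtype]

/-! ### Planarity of the drawing -/

theorem oblique_injective {x y x' y' : ℝ}
    (h : (x : ℂ) + y * Complex.exp ((Real.pi / 3 : ℝ) * Complex.I) =
      x' + y' * Complex.exp ((Real.pi / 3 : ℝ) * Complex.I)) : x = x' ∧ y = y' := by
  have him := congrArg Complex.im h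
  have hre := congrArg Complex.re h
  simp only [Complex.add_im, Complex.add_re, Complex.ofReal_im, Complex.ofReal_re,
    Complex.re_ofReal_mul, Complex.im_ofReal_mul, Complex.exp_ofReal_mul_I_re,
    Complex.exp_ofReal_mul_I_im, Real.cos_pi_div_three, Real.sin_pi_div_three, zero_add] at him hre
  have hy : y = y' := mul_right_cancel₀ (by positivity) him
  exact ⟨by linarith, hy⟩

theorem toPlane_eq (p : Pt) : p.toPlane = ((p.1 : ℝ) : ℂ) +
    ((p.2 : ℝ) : ℂ) * Complex.exp ((Real.pi / 3 : ℝ) * Complex.I) := by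
  simp [Pt.toPlane]

theorem toPlane_injective : Function.Injective Pt.toPlane := by
  intro p q h
  rw [toPlane_eq, toPlane_eq] at h
  obtain ⟨h₁, h₂⟩ := oblique_injective h
  exact Prod.ext (by exact_mod_cast h₁) (by exact_mod_cast h₂)

/-- A point of an open edge, with the edge oriented in one of the first three directions. -/
theorem exists_of_mem_openSegment {u v : specialCenters a} (h : (graphT a).graph.Adj u v) {z : ℂ}
    (hz : z ∈ openSegment ℝ ((graphT a).pos u) ((graphT a).pos v)) :
    ∃ (p q : specialCenters a) (k : Fin 6) (s : ℝ), s(u, v) = s(p, q) ∧ (q : Pt) = nbr p k ∧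
      k < 3 ∧ 0 < s ∧ s < 1 ∧
      z = (((p : Pt).1 + s * ((q : Pt).1 - (p : Pt).1) : ℝ) : ℂ) +
        (((p : Pt).2 + s * ((q : Pt).2 - (p : Pt).2) : ℝ) : ℂ) *
          Complex.exp ((Real.pi / 3 : ℝ) * Complex.I) := by
  have param : ∀ p q : specialCenters a,
      z ∈ openSegment ℝ ((graphT a).pos p) ((graphT a).pos q) → ∃ s : ℝ, 0 < s ∧ s < 1 ∧
        z = (((p : Pt).1 + s * ((q : Pt).1 - (p : Pt).1) : ℝ) : ℂ) +
          (((p : Pt).2 + s * ((q : Pt).2 - (p : Pt).2) : ℝ) : ℂ) *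
            Complex.exp ((Real.pi / 3 : ℝ) * Complex.I) := by
    rintro p q ⟨r, s, hr, hs, hrs, rfl⟩
    refine ⟨s, hs, by linarith, ?_⟩
    obtain rfl : r = 1 - s := by linarith
    simp only [graphT, Pt.toPlane, Complex.real_smul]
    push_cast
    ring
  obtain ⟨k, hk⟩ := graphT_adj.1 h
  by_cases hk3 : k < 3
  · obtain ⟨s, hs⟩ := param u v hz
    exact ⟨u, v, k, s, rfl, hk, hk3, hs⟩
  · rw [openSegment_symm] at hz
    obtain ⟨s, hs⟩ := param v u hz
    have : ∀ k : Fin 6, ¬ k < 3 → k + 3 < 3 := by decide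
    exact ⟨v, u, k + 3, s, Sym2.eq_swap, by rw [hk, nbr_nbr], this k hk3, hs⟩

theorem nbr_of_lt_three {p : Pt} {k : Fin 6} (hk : k < 3) :
    nbr p k = (p.1 + 1, p.2 + 1) ∨ nbr p k = (p.1 - 1, p.2 + 2) ∨
      nbr p k = (p.1 - 2, p.2 + 1) := by
  fin_cases k <;> simp [nbr] at hk ⊢

theorem int_ne_of_mem_Ioo {s : ℝ} (h0 : 0 < s) (h1 : s < 1) (m : ℤ) : s ≠ m := by
  rintro rfl
  have h0' : (0 : ℤ) < m := by exact_mod_cast h0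
  have h1' : m < (1 : ℤ) := by exact_mod_cast h1
  omega

/-- Two unit edges of the sublattice of one colour class whose interiors meet are equal. -/
theorem eq_of_openSegment_inter {p q p' q' : Pt} {k l : Fin 6} {s t : ℝ}
    (hpp : (p.1 - p.2) % 3 = (p'.1 - p'.2) % 3) (hq : q = nbr p k) (hq' : q' = nbr p' l)
    (hk : k < 3) (hl : l < 3) (hs0 : 0 < s) (hs1 : s < 1) (ht0 : 0 < t) (ht1 : t < 1)
    (h₁ : (p.1 + s * (q.1 - p.1) : ℝ) = p'.1 + t * (q'.1 - p'.1))
    (h₂ : (p.2 + s * (q.2 - p.2) : ℝ) = p'.2 + t * (q'.2 - p'.2)) : p = p' ∧ q = q' := by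
  obtain ⟨x, y⟩ := p
  obtain ⟨x', y'⟩ := p'
  -- Points of one class differ by a vector (m, m + 3r). Parallel edges then give an integer value
  -- of t - s, hence 0; for other directions s or t would be an integer.
  obtain ⟨m, rfl⟩ : ∃ m, x = x' + m := ⟨x - x', by ring⟩
  obtain ⟨r, rfl⟩ : ∃ r, y = y' + m + 3 * r := ⟨(y - y' - m) / 3, by dsimp only at hpp; omega⟩
  have sne := int_ne_of_mem_Ioo hs0 hs1
  have tne := int_ne_of_mem_Ioo ht0 ht1
  have int_zero : ∀ m : ℤ, (m : ℝ) = t - s → m = 0 := by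
    intro m hm
    have h1 : (m : ℝ) < 1 := by linarith
    have h2 : (-1 : ℝ) < m := by linarith
    have h1' : m < 1 := by exact_mod_cast h1
    have h2' : -1 < m := by exact_mod_cast h2
    omega
  rcases nbr_of_lt_three (p := (x' + m, y' + m + 3 * r)) hk with h | h | h <;>
    rcases nbr_of_lt_three (p := (x', y')) hl with h' | h' | h' <;>
    rw [h] at hq <;> rw [h'] at hq' <;> subst hq hq' <;> push_cast at h₁ h₂
  · obtain rfl := int_zero m (by linarith)
    obtain rfl : r = 0 := by
      have : (r : ℝ) = 0 := by push_cast at h₁ h₂; linarith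
      exact_mod_cast this
    simp
  · exact absurd (by linarith) (tne r)
  · exact absurd (by push_cast; linarith) (sne (-m - 2 * r))
  · exact absurd (by push_cast; linarith) (sne (-r))
  · obtain rfl : r = 0 := int_zero r (by linarith)
    obtain rfl : m = 0 := by
      have := int_zero (-m) (by push_cast at h₁ h₂ ⊢; linarith)
      omega
    simp
  · obtain rfl : r = 0 := by
      exact int_zero r (by linarith)
    exact absurd (by push_cast at h₁ h₂ ⊢; linarith) (sne (-m))
  · exact absurd (by push_cast; linarith) (sne (-r))
  · obtain rfl : r = 0 := int_zero r (by linarith)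
    exact absurd (by push_cast at h₁ h₂ ⊢; linarith) (sne m)
  · obtain rfl : r = 0 := int_zero r (by linarith)
    obtain rfl : m = 0 := int_zero m (by push_cast at h₁ h₂ ⊢; linarith)
    simp

/-- In each of the three directions some coordinate changes by exactly 1, so a lattice point on the
edge has an integer parameter. -/
theorem toPlane_notMem_openSegment {u v w : specialCenters a} (h : (graphT a).graph.Adj u v) :
    (graphT a).pos w ∉ openSegment ℝ ((graphT a).pos u) ((graphT a).pos v) := by
  intro hz
  obtain ⟨⟨⟨x, y⟩, _⟩, q, k, s, -, hq, hk, hs0, hs1, hz⟩ := exists_of_mem_openSegment h hz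
  obtain ⟨⟨x', y'⟩, _⟩ := w
  obtain ⟨h₁, h₂⟩ := oblique_injective ((toPlane_eq _).symm.trans hz)
  have sne := int_ne_of_mem_Ioo hs0 hs1
  rcases nbr_of_lt_three (p := (x, y)) hk with h | h | h <;> simp only [hq, h] at h₁ h₂ <;>
    push_cast at h₁ h₂
  · exact sne (x' - x) (by push_cast; linarith)
  · exact sne (x - x') (by push_cast; linarith)
  · exact sne (y' - y) (by push_cast; linarith)

theorem graphT_isPlane (a : ℕ) : (graphT a).IsPlane := by
  have vertex : ∀ u v w, (graphT a).graph.Adj u v →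
      (graphT a).pos w ∈ segment ℝ ((graphT a).pos u) ((graphT a).pos v) → w = u ∨ w = v := by
    intro u v w h hw
    have inj : Function.Injective (graphT a).pos :=
      toPlane_injective.comp Subtype.val_injective
    rw [← insert_endpoints_openSegment] at hw
    obtain hw | hw | hw := hw
    · exact Or.inl (inj hw)
    · exact Or.inr (inj hw)
    · exact absurd hw (toPlane_notMem_openSegment h)
  refine ⟨toPlane_injective.comp Subtype.val_injective, fun u v w => vertex u v w, ?_⟩
  intro u v x y huv hxy hne z hz hz'
  have hz₀ := hz
  have hz₀' := hz'
  rw [← insert_endpoints_openSegment] at hz hz'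
  obtain rfl | rfl | hz := hz
  · exact ⟨u, Or.inl rfl, vertex x y u hxy hz₀', rfl⟩
  · exact ⟨v, Or.inr rfl, vertex x y v hxy hz₀', rfl⟩
  obtain rfl | rfl | hz' := hz'
  · exact ⟨x, vertex u v x huv hz₀, Or.inl rfl, rfl⟩
  · exact ⟨y, vertex u v y huv hz₀, Or.inr rfl, rfl⟩
  obtain ⟨p, q, k, s, he, hq, hk, hs0, hs1, hz⟩ := exists_of_mem_openSegment huv hz
  obtain ⟨p', q', l, t, he', hq', hl, ht0, ht1, hz'⟩ := exists_of_mem_openSegment hxy hz'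
  obtain ⟨h₁, h₂⟩ := oblique_injective (hz.symm.trans hz')
  obtain ⟨hp, hq⟩ := eq_of_openSegment_inter (specialCenters_class p p') hq hq' hk hl hs0 hs1
    ht0 ht1 h₁ h₂
  exact absurd (by rw [he, he', Subtype.ext hp, Subtype.ext hq]) hne

end LucasTiling

theorem theorem4 (a : ℕ) :
    (∀ t ∈ regionT a, ∃! p, p ∈ specialCenters a ∧ t ∈ hexagonAt p) ∧
    (graphT a).IsPlane ∧
    numLozengeTilings (regionT a) = ∑ A ∈ (graphT a).Luc, 2 ^ (graphT a).Sp A :=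
  ⟨fun _ => existsUnique_specialCenters, graphT_isPlane a, numLozengeTilings_eq_sum_Luc⟩
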